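/- Let $d\ge 3$ be an integer and let $t$ be a real number with $$\frac{\sqrt{d-1}}{2}<t<\frac{\sqrt d}{2}.$$ Let $H$ be a hyperplane of $\mathbb{R}^d$ at Euclidean distance $t$ from the center $(\tfrac12,\dots,\tfrac12)$ of the hypercube $[0,1]^d$. Then the $(d-1)$-dimensional volume of $H\cap[0,1]^d$ is at most $$\frac{d^{d/2}}{(d-1)!}\left(\frac{\sqrt d}{2}-t\right)^{d-1},$$ with equality if and only if $H$ is orthogonal to a diagonal of $[0,1]^d$, that is, to a segment joining two opposite vertices of $[0,1]^d$ (vertices symmetric to each other about the center). -/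

import Mathlib

open scoped MeasureTheory

namespace CubeSection

/-- The hypercube `[0,1]^d` in Euclidean space. -/
def cube (d : ℕ) : Set (EuclideanSpace ℝ (Fin d)) :=
  {x | ∀ i, x i ∈ Set.Icc (0 : ℝ) 1}

/-- The center `(1/2, …, 1/2)` of the hypercube. -/
noncomputable def center (d : ℕ) : EuclideanSpace ℝ (Fin d) :=
  WithLp.toLp 2 (fun _ => (1 / 2 : ℝ))

/-- A hyperplane: the solution set of `a · x = b` with `a` a non-zero vector. -/
def IsHyperplane {d : ℕ} (H : Set (EuclideanSpace ℝ (Fin d))) : Prop :=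
  ∃ a : EuclideanSpace ℝ (Fin d), a ≠ 0 ∧ ∃ b : ℝ, H = {x | inner ℝ a x = b}

/-- A vertex of the hypercube: all the coordinates are `0` or `1`. -/
def IsVertex {d : ℕ} (p : EuclideanSpace ℝ (Fin d)) : Prop :=
  ∀ i, p i = 0 ∨ p i = 1

/-- The segment from `p` to `q` is a diagonal of the hypercube:
`p` and `q` are vertices, opposite to each other with respect to the center. -/
def IsDiagonal {d : ℕ} (p q : EuclideanSpace ℝ (Fin d)) : Prop :=
  IsVertex p ∧ IsVertex q ∧ midpoint ℝ p q = center d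

/-- The set `H` (in use, a hyperplane) is orthogonal to some diagonal of the hypercube:
all the differences of two points of `H` are orthogonal to the direction of that diagonal. -/
def IsOrthogonalToADiagonal {d : ℕ} (H : Set (EuclideanSpace ℝ (Fin d))) : Prop :=
  ∃ p q : EuclideanSpace ℝ (Fin d), IsDiagonal p q ∧
    ∀ x ∈ H, ∀ y ∈ H, inner ℝ (x - y) (q - p) = 0

/-- The `(d-1)`-dimensional volume of `H ∩ [0,1]^d`: the Hausdorff measure of dimension `d - 1`,
normalized so as to agree with the `(d-1)`-dimensional Lebesgue measure. -/
noncomputable def sectionVolume {d : ℕ} (H : Set (EuclideanSpace ℝ (Fin d))) : ENNReal :=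
  μHE[d - 1] (H ∩ cube d)

end CubeSection

open scoped MeasureTheory
namespace CubeSection

/-! Put `d = n + 1` and let `σ` be the coordinate sum of a unit normal `a`. Reflecting the cube
(`sectionVolume_eq_absVec`) makes all coordinates of `a` nonnegative, so that the section lies in
the slice `⟪a, x⟫ = s` of the positive orthant, where `s = σ / 2 - t`. If `s > 0`, then `σ > √n`,
which forces every `a i > 0`. The slice is then a simplex of volume `s ^ n / (n! ∏ a i)`
(`volume_simplexSection`). When `a` is parallel to a diagonal, `σ = √(n + 1)`, the simplex fits
inside the cube and its volume is the bound.

For any other normal a strict inequality between simplex volumes remains (`simplex_ineq`). Since `σ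
< √(n + 1)`, the ratio `(σ / 2 - t) / (√(n + 1) / 2 - t)` decreases in `t`, so it suffices to treat
the critical value `t = √n / 2` (`critical_ineq`). There only `σ` and `∏ a i` matter. For fixed sum
and sum of squares the product is least when `n` coordinates equal some `x` and one equals `y < x`
(`pow_mul_le_prod`). With `√n x = cos θ` and `y = sin θ`, the half-angle tangent turns what is left
into the monotonicity of one explicit function (`halfAngleLog_le`). -/

/-! ### Minimising a product with prescribed sum and sum of squares -/

/-- The quadratic that interpolates `log` doubly at `x` and simply at `y < x` stays below `log`
to the right of `y`. -/
lemma hermite_le_log {x y z : ℝ} (hy : 0 < y) (hyx : y < x) (hyz : y ≤ z) :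
    Real.log x + (z - x) / x +
      (Real.log y - Real.log x - (y - x) / x) / (y - x) ^ 2 * (z - x) ^ 2 ≤ Real.log z := by
  have hx : 0 < x := hy.trans hyx
  have hyx' : y - x ≠ 0 := by linarith
  set C := (Real.log y - Real.log x - (y - x) / x) / (y - x) ^ 2 with hC
  set f : ℝ → ℝ := fun w => Real.log w - (Real.log x + (w - x) / x + C * (w - x) ^ 2) with hf
  have hder : ∀ w, 0 < w → HasDerivAt f (1 / w - (1 / x + C * (2 * (w - x)))) w := by
    intro w hw
    have h1 := Real.hasDerivAt_log hw.ne'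
    have h2 : HasDerivAt (fun w : ℝ => (w - x)) 1 w := (hasDerivAt_id w).sub_const x
    have h3 := ((h2.div_const x).const_add (Real.log x)).add ((h2.pow 2).const_mul C)
    refine (h1.sub h3).congr_deriv ?_
    simp
  have hfx : f x = 0 := by simp [hf]
  have hfy : f y = 0 := by
    simp only [hf, hC]
    field_simp
    ring
  have hcont : ∀ s : Set ℝ, s ⊆ Set.Ioi 0 → ContinuousOn f s := fun s hs w hw =>
    (hder w (hs hw)).continuousAt.continuousWithinAt
  -- Rolle gives a second critical point `c` in `(y, x)` besides `x`. It determines `C`, factors the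
  -- derivative, and shows that `f` rises on `[y, c]`, falls on `[c, x]` and rises after `x`, with
  -- value `0` at `y` and `x`.
  obtain ⟨c, hc, hc0⟩ := exists_hasDerivAt_eq_zero hyx
    (hcont _ fun w hw => lt_of_lt_of_le hy hw.1) (hfy.trans hfx.symm)
    (fun w hw => hder w (hy.trans hw.1))
  have hc_pos : 0 < c := hy.trans hc.1
  have hCval : C = -(1 / (2 * x * c)) := by
    have hcx : c - x ≠ 0 := by linarith [hc.2]
    have h : C * (2 * (c - x)) = 1 / c - 1 / x := by linarith
    have h' : 1 / c - 1 / x = -(1 / (2 * x * c)) * (2 * (c - x)) := by field_simp; ring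
    exact mul_right_cancel₀ (mul_ne_zero two_ne_zero hcx) (h.trans h')
  have hder' : ∀ w, 0 < w → HasDerivAt f ((w - x) * (w - c) / (x * c * w)) w := by
    intro w hw
    refine (hder w hw).congr_deriv ?_
    rw [hCval]
    field_simp
    ring
  have hpos : 0 ≤ f z := by
    rcases le_total z c with hzc | hcz
    · have := monotoneOn_of_hasDerivWithinAt_nonneg (convex_Icc y c)
        (hcont _ fun w hw => lt_of_lt_of_le hy hw.1)
        (fun w hw => (hder' w (by rw [interior_Icc] at hw; exact hy.trans hw.1)).hasDerivWithinAt)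
        (fun w hw => by
          rw [interior_Icc] at hw
          have : 0 < w := hy.trans hw.1
          exact div_nonneg (mul_nonneg_of_nonpos_of_nonpos (by linarith [hw.2, hc.2])
            (by linarith [hw.2])) (by positivity))
      rw [← hfy]
      exact this ⟨le_rfl, hc.1.le⟩ ⟨hyz, hzc⟩ hyz
    · rcases le_total z x with hzx | hxz
      · have := antitoneOn_of_hasDerivWithinAt_nonpos (convex_Icc c x)
          (hcont _ fun w hw => lt_of_lt_of_le hc_pos hw.1)
          (fun w hw => (hder' w (by rw [interior_Icc] at hw; exact hc_pos.trans hw.1)).hasDerivWithinAt)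
          (fun w hw => by
            rw [interior_Icc] at hw
            have : 0 < w := hc_pos.trans hw.1
            exact div_nonpos_of_nonpos_of_nonneg (mul_nonpos_of_nonpos_of_nonneg (by linarith [hw.2])
              (by linarith [hw.1])) (by positivity))
        rw [← hfx]
        exact this ⟨hcz, hzx⟩ ⟨hc.2.le, le_rfl⟩ hzx
      · have := monotoneOn_of_hasDerivWithinAt_nonneg (convex_Ici x)
          (hcont _ fun w hw => lt_of_lt_of_le hx hw)
          (fun w hw => (hder' w (by rw [interior_Ici] at hw; exact hx.trans hw)).hasDerivWithinAt)
          (fun w hw => by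
            rw [interior_Ici] at hw
            have hw' : x < w := hw
            have : 0 < w := hx.trans hw'
            exact div_nonneg (mul_nonneg (by linarith) (by linarith [hc.2])) (by positivity))
        rw [← hfx]
        exact this (Set.self_mem_Ici) hxz hxz
  simp only [hf] at hpos
  linarith

/-- Among the tuples with prescribed sum and sum of squares, the least coordinate is smallest when
all the other coordinates are equal. -/
lemma le_of_sum_eq_of_sum_sq_eq {n : ℕ} {a : Fin (n + 1) → ℝ} {x y : ℝ} (hyx : y ≤ x)
    (h₁ : ∑ i, a i = n * x + y) (h₂ : ∑ i, a i ^ 2 = n * x ^ 2 + y ^ 2) (i : Fin (n + 1)) :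
    y ≤ a i := by
  by_contra! h
  -- Cauchy–Schwarz for the `n` coordinates other than `a i`; a value `a i < y` would contradict it.
  have hcs := sq_sum_le_card_mul_sum_sq (s := Finset.univ.erase i) (f := a)
  rw [Finset.card_erase_of_mem (Finset.mem_univ i), Finset.card_univ, Fintype.card_fin,
    Nat.add_sub_cancel] at hcs
  have e₁ := Finset.add_sum_erase Finset.univ a (Finset.mem_univ i)
  have e₂ := Finset.add_sum_erase Finset.univ (fun i => a i ^ 2) (Finset.mem_univ i)
  have e₁' : ∑ j ∈ Finset.univ.erase i, a j = n * x + y - a i := by linarith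
  have e₂' : ∑ j ∈ Finset.univ.erase i, a j ^ 2 = n * x ^ 2 + y ^ 2 - a i ^ 2 := by
    linarith
  rw [e₁', e₂'] at hcs
  have hn : (0 : ℝ) ≤ n := n.cast_nonneg
  have he : 0 < y - a i := by linarith
  have : (y - a i) * (2 * n * (x - y) + (n + 1) * (y - a i)) ≤ 0 := by nlinarith
  have h' : 0 < 2 * n * (x - y) + (n + 1) * (y - a i) := by
    have := mul_nonneg hn (sub_nonneg.2 hyx)
    have := mul_nonneg hn he.le
    nlinarith
  linarith [mul_pos he h']

/-- Among the positive tuples with prescribed sum and sum of squares, the product is smallest when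
all the coordinates but the least one are equal. -/
lemma pow_mul_le_prod {n : ℕ} {a : Fin (n + 1) → ℝ} {x y : ℝ} (hy : 0 < y) (hyx : y < x)
    (h₁ : ∑ i, a i = n * x + y) (h₂ : ∑ i, a i ^ 2 = n * x ^ 2 + y ^ 2) :
    x ^ n * y ≤ ∏ i, a i := by
  have hx : 0 < x := hy.trans hyx
  have hya := le_of_sum_eq_of_sum_sq_eq hyx.le h₁ h₂
  have ha : ∀ i, 0 < a i := fun i => hy.trans_le (hya i)
  rw [← Real.log_le_log_iff (by positivity) (Finset.prod_pos fun i _ => ha i),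
    Real.log_mul (by positivity) hy.ne', Real.log_pow, Real.log_prod fun i _ => (ha i).ne']
  set C := (Real.log y - Real.log x - (y - x) / x) / (y - x) ^ 2 with hC
  -- The sum of a quadratic over the coordinates depends only on `∑ a i` and `∑ a i ^ 2`, so it may
  -- be computed at `(x, …, x, y)`, where the quadratic agrees with `log`.
  refine le_trans (le_of_eq ?_) (Finset.sum_le_sum fun i _ => hermite_le_log hy hyx (hya i))
  have hsplit : ∀ z : ℝ, Real.log x + (z - x) / x + C * (z - x) ^ 2 =
      (Real.log x - 1 + C * x ^ 2) + (1 / x - 2 * C * x) * z + C * z ^ 2 := by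
    intro z
    field_simp
    ring
  have hyx' : y - x ≠ 0 := by linarith
  have hly : Real.log y = Real.log x + (y - x) / x + C * (y - x) ^ 2 := by
    rw [hC]
    field_simp
    ring
  have hlx : Real.log x = Real.log x + (x - x) / x + C * (x - x) ^ 2 := by simp
  rw [← hC]
  simp_rw [hsplit]
  rw [Finset.sum_add_distrib, Finset.sum_add_distrib, ← Finset.mul_sum, ← Finset.mul_sum, h₁, h₂,
    Finset.sum_const, Finset.card_univ, Fintype.card_fin, nsmul_eq_mul, hly]
  rw [hsplit y]
  have hlx' := (hlx.trans (hsplit x))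
  push_cast
  linear_combination (n : ℝ) * hlx'

/-! ### The two-value case in the half-angle parameter -/

/-- Factors the numerator of the derivative of `halfAngleLog`. The factor `1 - 2 m u - u ^ 2`
vanishes at `u = √(m ^ 2 + 1) - m`, the endpoint of the monotonicity interval. -/
lemma logDeriv_numerator_eq (m u : ℝ) :
    (1 - m * u) * ((m ^ 2 - 1) * (1 - u ^ 4) + 2 * u ^ 2 * (1 - u ^ 2) +
        2 * m ^ 2 * u ^ 2 * (1 + u ^ 2)) - m ^ 2 * m * u * (1 - u ^ 4) =
      (1 - 2 * m * u - u ^ 2) * ((m ^ 2 - 1) - m * u + (m ^ 2 + 1) * u ^ 2 - m * u ^ 3) := by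
  ring

/-- The function whose monotonicity gives the two-value case of the product inequality. -/
noncomputable def halfAngleLog (m u : ℝ) : ℝ :=
  (m ^ 2 - 1) * Real.log u + m ^ 2 * Real.log (1 - m * u) + Real.log (1 + u ^ 2) -
    m ^ 2 * Real.log (1 - u ^ 2)

lemma halfAngleLog_le {m p u : ℝ} (hm : 2 ≤ m ^ 2) (hm₀ : 0 < m)
    (hp : p ^ 2 = m ^ 2 + 1) (hu : 0 < u) (hup : u ≤ p - m) :
    halfAngleLog m u ≤ halfAngleLog m (p - m) := by
  have key : ∀ w, 0 < w → w ≤ p - m → 0 ≤ 1 - 2 * m * w - w ^ 2 := by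
    intro w hw hwp
    nlinarith [mul_nonneg (sub_nonneg.2 hwp) (by linarith : 0 ≤ p + (w + m))]
  have hm1 : 1 < m := by nlinarith
  have hd : ∀ w, 0 < w → w ≤ p - m → ∃ f', HasDerivAt (halfAngleLog m) f' w ∧ 0 ≤ f' := by
    intro w hw hwp
    have hk := key w hw hwp
    have hmw : 2 * (m * w) < 1 := by nlinarith [sq_pos_of_pos hw]
    have hw1 : w < 1 / 2 := by nlinarith
    have p₁ : 0 < 1 - m * w := by nlinarith [mul_pos hm₀ hw]
    have p₂ : 0 < 1 + w ^ 2 := by positivity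
    have p₃ : 0 < 1 - w ^ 2 := by nlinarith
    have d₁ := (Real.hasDerivAt_log hw.ne').const_mul (m ^ 2 - 1)
    have d₂ := (((((hasDerivAt_id w).const_mul m).const_sub 1).log
      (by simpa using p₁.ne')).const_mul (m ^ 2))
    have d₃ := ((((hasDerivAt_id w).pow 2).const_add 1).log (by simpa using p₂.ne'))
    have d₄ := (((((hasDerivAt_id w).pow 2).const_sub 1).log
      (by simpa using p₃.ne')).const_mul (m ^ 2))
    refine ⟨_, ((d₁.add d₂).add d₃).sub d₄, ?_⟩
    have : (m ^ 2 - 1) * w⁻¹ + m ^ 2 * (-m / (1 - m * w)) + 2 * w / (1 + w ^ 2) -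
        m ^ 2 * (-(2 * w) / (1 - w ^ 2)) =
        (1 - 2 * m * w - w ^ 2) * ((m ^ 2 - 1) - m * w + (m ^ 2 + 1) * w ^ 2 - m * w ^ 3) /
          (w * (1 - m * w) * (1 + w ^ 2) * (1 - w ^ 2)) := by
      rw [← logDeriv_numerator_eq]
      have := p₁.ne'
      have := p₂.ne'
      have := p₃.ne'
      field_simp
      ring
    have hQ : 0 ≤ (m ^ 2 - 1) - m * w + (m ^ 2 + 1) * w ^ 2 - m * w ^ 3 := by
      have : m * w ^ 3 ≤ w ^ 2 := by nlinarith [sq_nonneg w]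
      nlinarith [sq_nonneg w, mul_nonneg (sq_nonneg m) (sq_nonneg w)]
    have hfin : 0 ≤ (m ^ 2 - 1) * w⁻¹ + m ^ 2 * (-m / (1 - m * w)) + 2 * w / (1 + w ^ 2) -
        m ^ 2 * (-(2 * w) / (1 - w ^ 2)) := by
      rw [this]
      exact div_nonneg (mul_nonneg hk hQ) (by positivity)
    simpa using hfin
  choose! f' hf' hf'0 using hd
  have hmono : MonotoneOn (halfAngleLog m) (Set.Icc u (p - m)) := by
    refine monotoneOn_of_hasDerivWithinAt_nonneg (f' := f') (convex_Icc u (p - m)) ?_ ?_ ?_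
    · intro w hw
      exact (hf' w (hu.trans_le hw.1) hw.2).continuousAt.continuousWithinAt
    · intro w hw
      rw [interior_Icc] at hw
      exact (hf' w (hu.trans hw.1) hw.2.le).hasDerivWithinAt
    · intro w hw
      rw [interior_Icc] at hw
      exact hf'0 w (hu.trans hw.1) hw.2.le
  exact hmono ⟨le_rfl, hup⟩ ⟨hup, le_rfl⟩ hup

/-- With `m ^ 2 = n`, the fractions are `σ - √n`, `x` and `y` in terms of `u`; the two-value
inequality thus compares `halfAngleLog` at `u` and at the endpoint. -/
lemma log_two_value_eq {m u : ℝ} (hm₀ : 0 < m) (hu : 0 < u) (h₁ : 0 < 1 - m * u)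
    (h₂ : 0 < 1 - u ^ 2) :
    m ^ 2 * Real.log (2 * u * (1 - m * u) / (1 + u ^ 2)) -
      (m ^ 2 * Real.log ((1 - u ^ 2) / ((1 + u ^ 2) * m)) + Real.log (2 * u / (1 + u ^ 2))) =
      halfAngleLog m u + ((m ^ 2 - 1) * Real.log 2 + m ^ 2 * Real.log m) := by
  have h₃ : 0 < 1 + u ^ 2 := by positivity
  rw [Real.log_div (by positivity) h₃.ne', Real.log_mul (by positivity) h₁.ne',
    Real.log_div h₂.ne' (by positivity), Real.log_mul h₃.ne' hm₀.ne',
    Real.log_div (by positivity) h₃.ne', Real.log_mul two_ne_zero hu.ne', halfAngleLog]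
  ring

/-- The two-value case of the product inequality. -/
lemma two_value_ineq {n : ℕ} (hn : 2 ≤ n) {x y : ℝ} (hy : 0 < y) (hyx : y ≤ x)
    (hxy : n * x ^ 2 + y ^ 2 = 1) (hσ : √n < n * x + y) :
    ((n * x + y - √n) / (√(n + 1) - √n)) ^ n ≤ √(n + 1) ^ (n + 1) * (x ^ n * y) := by
  set m := √(n : ℝ) with hm
  set p := √((n : ℝ) + 1) with hp
  have hn' : (2 : ℝ) ≤ n := by exact_mod_cast hn
  have hm2 : m ^ 2 = n := Real.sq_sqrt (by positivity)
  have hp2 : p ^ 2 = m ^ 2 + 1 := by rw [hm2]; exact Real.sq_sqrt (by positivity)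
  have hm₀ : 0 < m := Real.sqrt_pos.2 (by linarith)
  have hp₀ : 0 < p := Real.sqrt_pos.2 (by linarith)
  rw [← hm2] at hσ hxy hn' ⊢
  have hx : 0 < x := hy.trans_le hyx
  have hc : 0 < p - m := by nlinarith
  have hD : 0 < 1 + m * x := by positivity
  -- `u = tan (θ / 2)` for `m x = cos θ`, `y = sin θ`.
  set u := y / (1 + m * x) with hu_def
  have hu : 0 < u := by positivity
  have hyu : y = u * (1 + m * x) := by rw [hu_def]; field_simp
  have hu2 : 1 + u ^ 2 = 2 / (1 + m * x) := by
    rw [hu_def]; field_simp; nlinarith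
  have hu2' : 1 - u ^ 2 = 2 * (m * x) / (1 + m * x) := by
    rw [hu_def]; field_simp; nlinarith
  have hxu : x = (1 - u ^ 2) / ((1 + u ^ 2) * m) := by
    rw [hu2, hu2']; field_simp
  have hyu' : y = 2 * u / (1 + u ^ 2) := by
    rw [hu2, hu_def]; field_simp
  have hE : m ^ 2 * x + y - m = 2 * u * (1 - m * u) / (1 + u ^ 2) := by
    have h3 : 0 < 1 + u ^ 2 := by positivity
    rw [hxu, hyu']; field_simp; ring
  have hEpos : 0 < m ^ 2 * x + y - m := by linarith
  have hmu : 0 < 1 - m * u := by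
    have h3 : 0 < 1 + u ^ 2 := by positivity
    rw [hE] at hEpos
    by_contra! h
    have : 2 * u * (1 - m * u) / (1 + u ^ 2) ≤ 0 :=
      div_nonpos_of_nonpos_of_nonneg (mul_nonpos_of_nonneg_of_nonpos (by positivity) h) h3.le
    linarith
  -- In terms of `u`, the condition `y ≤ x` reads `2 m u ≤ 1 - u ^ 2`, that is `(u + m) ^ 2 ≤ p ^
  -- 2`.
  have hup : u ≤ p - m := by
    have h4 : 2 * m * u ≤ 1 - u ^ 2 := by
      rw [hu2', hu_def, ← mul_div_assoc]
      gcongr ?_ / _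
      nlinarith
    have h5 : (u + m) ^ 2 ≤ p ^ 2 := by nlinarith
    have := abs_le_of_sq_le_sq' h5 hp₀.le
    linarith [this.2]
  have hL := halfAngleLog_le hn' hm₀ hp2 hu hup
  -- At `u = c` both `x` and `y` are `1 / p` and `σ - m = c`: the diagonal normal, where equality
  -- holds.
  set c := p - m with hcdef
  have hpm : p = m + c := by rw [hcdef]; ring
  have e₁ : 1 + c ^ 2 = 2 * p * c := by rw [hcdef]; linear_combination -hp2
  have e₂ : 1 - m * c = p * c := by rw [hcdef]; linear_combination -hp2
  have e₃ : 1 - c ^ 2 = 2 * m * c := by rw [hcdef]; linear_combination -hp2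
  have i₁ := log_two_value_eq hm₀ hu hmu (by rw [hu2']; positivity)
  have i₂ := log_two_value_eq hm₀ hc (by rw [e₂]; positivity) (by rw [e₃]; positivity)
  rw [← hE, ← hxu, ← hyu'] at i₁
  have j₁ : 2 * c * (1 - m * c) / (1 + c ^ 2) = c := by rw [e₁, e₂]; field_simp
  have j₂ : (1 - c ^ 2) / ((1 + c ^ 2) * m) = 1 / p := by rw [e₁, e₃]; field_simp
  have j₃ : 2 * c / (1 + c ^ 2) = 1 / p := by rw [e₁]; field_simp
  rw [j₁, j₂, j₃] at i₂
  rw [← Real.log_le_log_iff (by positivity) (by positivity), Real.log_pow,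
    Real.log_mul (by positivity) (by positivity), Real.log_pow,
    Real.log_mul (by positivity) hy.ne', Real.log_pow, Real.log_div hEpos.ne' hc.ne', ← hm2]
  rw [one_div, Real.log_inv] at i₂
  push_cast
  rw [← hm2]
  linarith

/-! ### The inequality between simplex volumes -/

/-- The product inequality at the critical distance `√n / 2`, where `n = d - 1`. -/
lemma critical_ineq {n : ℕ} (hn : 2 ≤ n) {a : Fin (n + 1) → ℝ} (h₂ : ∑ i, a i ^ 2 = 1)
    (hσ : √n < ∑ i, a i) (hσ' : ∑ i, a i < √(n + 1)) :
    ((∑ i, a i - √n) / (√(n + 1) - √n)) ^ n ≤ √(n + 1) ^ (n + 1) * ∏ i, a i := by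
  set σ := ∑ i, a i with hσdef
  have hn' : (2 : ℝ) ≤ n := by exact_mod_cast hn
  have hσ0 : 0 < σ := (Real.sqrt_nonneg _).trans_lt hσ
  have hσn : (n : ℝ) < σ ^ 2 := (Real.sqrt_lt' hσ0).1 hσ
  have hσd : σ ^ 2 < n + 1 := (Real.lt_sqrt hσ0.le).1 hσ'
  -- Discriminant of the system `n x + y = σ`, `n x ^ 2 + y ^ 2 = 1`; the root with `y < x` is
  -- taken, and `σ > √n` makes it positive.
  set r := √(n * (n + 1 - σ ^ 2)) with hr
  have hrad : 0 < n * (n + 1 - σ ^ 2) := mul_pos (by linarith) (by linarith)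
  have hr2 : r ^ 2 = n * (n + 1 - σ ^ 2) := Real.sq_sqrt hrad.le
  have hr0 : 0 < r := Real.sqrt_pos.2 hrad
  have hrσ : r < σ := (Real.sqrt_lt' hσ0).2 (by nlinarith)
  set y := (σ - r) / (n + 1) with hy
  set x := (σ - y) / n with hx
  have hy0 : 0 < y := div_pos (by linarith) (by linarith)
  have hyx : y < x := by
    rw [hx, lt_div_iff₀ (by linarith)]
    have : y * (n + 1) = σ - r := by rw [hy]; field_simp
    linarith
  have h1 : σ = n * x + y := by rw [hx]; field_simp; ring
  have h2 : n * x ^ 2 + y ^ 2 = 1 := by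
    have e : n * x = σ - y := by linarith
    have e' : (n + 1) * y = σ - r := by rw [hy]; field_simp
    have : n * (n * x ^ 2 + y ^ 2) = n * 1 := by
      have e'' : ((n + 1) * y - σ) ^ 2 = r ^ 2 := by rw [e']; ring
      have : (n + 1) * (n * (n * x ^ 2 + y ^ 2)) = (n + 1) * (n * 1) := by
        have : n * (n * x ^ 2 + y ^ 2) = (σ - y) ^ 2 + n * y ^ 2 := by rw [← e]; ring
        rw [this]
        nlinarith
      exact mul_left_cancel₀ (by positivity) this
    exact mul_left_cancel₀ (by positivity) this
  have hprod := pow_mul_le_prod hy0 hyx (a := a) (by rw [← hσdef, h1]) (by rw [h₂, h2])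
  have h2v := two_value_ineq hn hy0 hyx.le h2 (by rw [← h1]; exact hσ)
  rw [← h1] at h2v
  exact h2v.trans (mul_le_mul_of_nonneg_left hprod (by positivity))

/-- The strict inequality between the simplex volumes. -/
lemma simplex_ineq {n : ℕ} (hn : 2 ≤ n) {a : Fin (n + 1) → ℝ} (h₂ : ∑ i, a i ^ 2 = 1) {t : ℝ}
    (ht : √n / 2 < t) (hs : 0 < (∑ i, a i) / 2 - t) (hσ' : ∑ i, a i < √(n + 1)) :
    ((∑ i, a i) / 2 - t) ^ n < √(n + 1) ^ (n + 1) * (√(n + 1) / 2 - t) ^ n * ∏ i, a i := by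
  have hσ : √n < ∑ i, a i := by linarith
  have hc := critical_ineq hn h₂ hσ hσ'
  set σ := ∑ i, a i
  set m := √(n : ℝ)
  set p := √((n : ℝ) + 1)
  have hpt : 0 < p / 2 - t := by linarith
  -- Comparison of the ratio at `t` with its value at `m / 2 < t`; the strictness of the final
  -- inequality comes from here.
  have hlt : (σ / 2 - t) / (p / 2 - t) < (σ - m) / (p - m) := by
    rw [div_lt_div_iff₀ hpt (by linarith)]
    nlinarith [mul_pos (sub_pos.2 hσ') (by linarith : 0 < 2 * t - m)]
  have := (pow_lt_pow_left₀ hlt (by positivity) (by omega : n ≠ 0)).trans_le hc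
  rw [div_pow, div_lt_iff₀ (by positivity)] at this
  linarith

open MeasureTheory

/-! ### Volume of a simplex section of the orthant -/

/-- The closed positive orthant. -/
def orthant (d : ℕ) : Set (EuclideanSpace ℝ (Fin d)) := {x | ∀ i, 0 ≤ x i}

lemma isClosed_orthant (d : ℕ) : IsClosed (orthant d) := by
  simp only [orthant, Set.ofPred_forall]
  exact isClosed_iInter fun i => isClosed_le continuous_const (by fun_prop)

lemma smul_mem_orthant_iff {d : ℕ} {r : ℝ} (hr : 0 < r) {x : EuclideanSpace ℝ (Fin d)} :
    r • x ∈ orthant d ↔ x ∈ orthant d := by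
  simp [orthant, mul_nonneg_iff_of_pos_left hr]

/-- The simplex cut out of the positive orthant by `⟪a, x⟫ = s`. -/
def simplexSection {d : ℕ} (a : EuclideanSpace ℝ (Fin d)) (s : ℝ) :
    Set (EuclideanSpace ℝ (Fin d)) :=
  orthant d ∩ {x | inner ℝ a x = s}

open scoped Pointwise in
lemma simplexSection_eq_smul {d : ℕ} (a : EuclideanSpace ℝ (Fin d)) {s : ℝ} (hs : 0 < s) :
    simplexSection a s = s • simplexSection a 1 := by
  ext x
  rw [Set.mem_smul_set_iff_inv_smul_mem₀ hs.ne']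
  simp only [simplexSection, Set.mem_inter_iff, smul_mem_orthant_iff (inv_pos.2 hs),
    Set.mem_ofPred_eq, inner_smul_right]
  rw [inv_mul_eq_one₀ hs.ne', eq_comm (a := s)]

lemma measure_simplexSection {d : ℕ} (k : ℕ) (a : EuclideanSpace ℝ (Fin d)) {s : ℝ} (hs : 0 < s) :
    μHE[k] (simplexSection a s) = ENNReal.ofReal (s ^ k) * μHE[k] (simplexSection a 1) := by
  rw [simplexSection_eq_smul a hs, Measure.euclideanHausdorffMeasure_smul₀ k hs.ne',
    ENNReal.smul_def, smul_eq_mul, ENNReal.ofReal_pow hs.le]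
  simp [ENNReal.ofReal, Real.nnnorm_of_nonneg hs.le, Real.toNNReal_of_nonneg hs.le]

lemma inner_nonneg_of_mem_orthant {d : ℕ} {a : EuclideanSpace ℝ (Fin d)} (ha : ∀ i, 0 ≤ a i)
    {x : EuclideanSpace ℝ (Fin d)} (hx : x ∈ orthant d) : 0 ≤ inner ℝ a x := by
  rw [PiLp.inner_apply]
  exact Finset.sum_nonneg fun i _ => by simpa using mul_nonneg (hx i) (ha i)

/-- Slicing the positive orthant orthogonally to the unit vector `a`. -/
lemma volume_orthant_inter {n : ℕ} {a : EuclideanSpace ℝ (Fin (n + 1))} (ha : ‖a‖ = 1)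
    {B : Set ℝ} (hB : MeasurableSet B) :
    volume (orthant (n + 1) ∩ (fun x => inner ℝ a x) ⁻¹' B) =
      ∫⁻ r in B, μHE[n] (simplexSection a r) := by
  have hmeas : MeasurableSet (orthant (n + 1) ∩ (fun x => inner ℝ a x) ⁻¹' B) :=
    (isClosed_orthant _).measurableSet.inter
      ((Continuous.measurable (by fun_prop)) hB)
  have ha0 : a ≠ 0 := by rintro rfl; simp at ha
  have h := EuclideanGeometry.euclideanHausdorffMeasure_eq_lintegral
    (0 : EuclideanSpace ℝ (Fin (n + 1))) ha0 hmeas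
  rw [InnerProductSpace.euclideanHausdorffMeasure_eq_volume] at h
  rw [h, ← ofReal_norm, ha, ENNReal.ofReal_one, one_mul, ← lintegral_indicator hB]
  congr 1 with r
  rw [finrank_euclideanSpace_fin, Nat.add_sub_cancel]
  have hmem : ∀ x : EuclideanSpace ℝ (Fin (n + 1)),
      x ∈ AffineSubspace.mk' (r • a +ᵥ (0 : EuclideanSpace ℝ (Fin (n + 1)))) (Submodule.span ℝ {a})ᗮ
        ↔ inner ℝ a x = r := by
    intro x
    rw [AffineSubspace.mem_mk', Submodule.mem_orthogonal_singleton_iff_inner_right]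
    simp [inner_sub_right, inner_smul_right, ha, sub_eq_zero]
  by_cases hr : r ∈ B
  · rw [Set.indicator_of_mem hr]
    congr 1
    ext x
    simp only [simplexSection, Set.mem_inter_iff, SetLike.mem_coe, hmem, Set.mem_preimage,
      Set.mem_ofPred_eq]
    constructor
    · rintro ⟨⟨h1, -⟩, h3⟩; exact ⟨h1, h3⟩
    · rintro ⟨h1, h3⟩; exact ⟨⟨h1, h3 ▸ hr⟩, h3⟩
  · rw [Set.indicator_of_notMem hr]
    convert measure_empty (μ := (μHE[n] : Measure (EuclideanSpace ℝ (Fin (n + 1)))))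
    ext x
    simp only [Set.mem_inter_iff, SetLike.mem_coe, hmem, Set.mem_preimage,
      Set.mem_empty_iff_false, iff_false]
    rintro ⟨⟨-, h2⟩, h3⟩
    exact hr (h3 ▸ h2)

lemma integral_exp_neg_mul_Ici {b : ℝ} (hb : 0 < b) :
    ∫ x : ℝ, (Set.Ici (0 : ℝ)).indicator (fun x => Real.exp (-b * x)) x = 1 / b := by
  rw [integral_indicator measurableSet_Ici, integral_Ici_eq_integral_Ioi,
    integral_exp_mul_Ioi (by linarith) 0]
  simp

lemma lintegral_orthant_exp {n : ℕ} {a : EuclideanSpace ℝ (Fin n)} (ha : ∀ i, 0 < a i) :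
    ∫⁻ x in orthant n, ENNReal.ofReal (Real.exp (-inner ℝ a x)) =
      ENNReal.ofReal (∏ i, 1 / a i) := by
  rw [← lintegral_indicator (isClosed_orthant n).measurableSet,
    ← (PiLp.volume_preserving_toLp (Fin n)).lintegral_comp_emb
      (MeasurableEquiv.toLp 2 (Fin n → ℝ)).measurableEmbedding]
  have hfun : ∀ x : Fin n → ℝ, (orthant n).indicator
      (fun x => ENNReal.ofReal (Real.exp (-inner ℝ a x))) (WithLp.toLp 2 x) =
      ENNReal.ofReal (∏ i, (Set.Ici (0 : ℝ)).indicator (fun z => Real.exp (-a i * z)) (x i)) := by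
    intro x
    by_cases hx : WithLp.toLp 2 x ∈ orthant n
    · rw [Set.indicator_of_mem hx, Finset.prod_congr rfl fun i _ =>
        Set.indicator_of_mem (show x i ∈ Set.Ici 0 from hx i) _, ← Real.exp_sum]
      simp [PiLp.inner_apply, mul_comm]
    · rw [Set.indicator_of_notMem hx]
      simp only [orthant, Set.mem_ofPred_eq, not_forall] at hx
      obtain ⟨i, hi⟩ := hx
      rw [Finset.prod_eq_zero (Finset.mem_univ i) (Set.indicator_of_notMem hi _),
        ENNReal.ofReal_zero]
  simp_rw [hfun]
  rw [← ofReal_integral_eq_lintegral_ofReal]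
  · rw [integral_fintype_prod_volume_eq_prod
      (fun i => (Set.Ici (0 : ℝ)).indicator (fun z => Real.exp (-a i * z)))]
    simp_rw [integral_exp_neg_mul_Ici (ha _)]
  · refine Integrable.fintype_prod_dep
      (f := fun i => (Set.Ici (0 : ℝ)).indicator (fun z => Real.exp (-a i * z))) fun i => ?_
    rw [integrable_indicator_iff measurableSet_Ici, integrableOn_Ici_iff_integrableOn_Ioi]
    exact integrableOn_exp_mul_Ioi (by linarith [ha i]) 0
  · exact Filter.Eventually.of_forall fun x => Finset.prod_nonneg fun i _ =>
      Set.indicator_nonneg (fun z _ => (Real.exp_pos _).le) _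

lemma lintegral_pow_mul_exp (n : ℕ) :
    ∫⁻ r in Set.Ioi (0 : ℝ), ENNReal.ofReal (r ^ n * Real.exp (-r)) =
      ENNReal.ofReal n.factorial := by
  have hn : (0 : ℝ) < n + 1 := by positivity
  have hfun : ∀ r : ℝ, Real.exp (-r) * r ^ ((n : ℝ) + 1 - 1) = r ^ n * Real.exp (-r) := by
    intro r
    rw [add_sub_cancel_right, Real.rpow_natCast, mul_comm]
  have hint := Real.GammaIntegral_convergent hn
  simp_rw [hfun] at hint
  rw [← ofReal_integral_eq_lintegral_ofReal hint]
  · rw [← Real.Gamma_nat_eq_factorial, Real.Gamma_eq_integral hn]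
    simp_rw [hfun]
  · filter_upwards [ae_restrict_mem measurableSet_Ioi] with r hr
    exact mul_nonneg (pow_nonneg (le_of_lt hr) _) (Real.exp_pos _).le

/-- The slices are homothetic, so Lebesgue measure on the orthant, pushed forward along `⟪a, ·⟫`,
has density `r ^ n` times the volume of the slice at `1`. -/
lemma lintegral_orthant_comp_inner {n : ℕ} {a : EuclideanSpace ℝ (Fin (n + 1))} (ha : ‖a‖ = 1)
    (ha₀ : ∀ i, 0 < a i) {f : ℝ → ENNReal} (hf : Measurable f) :
    ∫⁻ x in orthant (n + 1), f (inner ℝ a x) =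
      μHE[n] (simplexSection a 1) * ∫⁻ r in Set.Ioi (0 : ℝ), ENNReal.ofReal (r ^ n) * f r := by
  have hcont : Measurable fun x : EuclideanSpace ℝ (Fin (n + 1)) => inner ℝ a x :=
    Continuous.measurable (by fun_prop)
  set K := μHE[n] (simplexSection a 1) with hK
  have hg : Measurable ((Set.Ioi (0 : ℝ)).indicator fun r : ℝ => ENNReal.ofReal (r ^ n) * K) :=
    Measurable.indicator (by fun_prop) measurableSet_Ioi
  have hmap : (volume.restrict (orthant (n + 1))).map (fun x => inner ℝ a x) =
      volume.withDensity ((Set.Ioi (0 : ℝ)).indicator fun r => ENNReal.ofReal (r ^ n) * K) := by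
    ext B hB
    rw [Measure.map_apply hcont hB, Measure.restrict_apply (hcont hB), Set.inter_comm,
      volume_orthant_inter ha hB, withDensity_apply _ hB]
    refine lintegral_congr_ae ?_
    filter_upwards [ae_restrict_of_ae (Measure.ae_ne volume (0 : ℝ))] with r hr
    rcases lt_or_gt_of_ne hr with h | h
    · rw [Set.indicator_of_notMem (by simpa using h.le)]
      convert measure_empty (μ := (μHE[n] : Measure (EuclideanSpace ℝ (Fin (n + 1)))))
      refine Set.eq_empty_of_forall_notMem fun x hx => ?_
      have := inner_nonneg_of_mem_orthant (fun i => (ha₀ i).le) hx.1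
      have h2 : inner ℝ a x = r := hx.2
      linarith
    · rw [Set.indicator_of_mem (Set.mem_Ioi.2 h), measure_simplexSection n a h]
  rw [← lintegral_map hf hcont, hmap, lintegral_withDensity_eq_lintegral_mul _ hg hf]
  simp_rw [Pi.mul_apply, ← Set.indicator_mul_left]
  rw [lintegral_indicator measurableSet_Ioi, ← lintegral_const_mul K (by fun_prop)]
  congr 1 with r
  ring

/-- The volume of the simplex cut out of the positive orthant by a hyperplane. -/
lemma volume_simplexSection {n : ℕ} {a : EuclideanSpace ℝ (Fin (n + 1))} (ha : ‖a‖ = 1)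
    (ha₀ : ∀ i, 0 < a i) {s : ℝ} (hs : 0 < s) :
    μHE[n] (simplexSection a s) = ENNReal.ofReal (s ^ n / (n.factorial * ∏ i, a i)) := by
  -- The integral of `exp (-⟪a, x⟫)` over the orthant, computed by slices and as a product of
  -- one-variable integrals, gives the volume of the slice at `1`.
  have h := lintegral_orthant_comp_inner ha ha₀
    (f := fun r => ENNReal.ofReal (Real.exp (-r))) (by fun_prop)
  rw [lintegral_orthant_exp ha₀] at h
  have h' : ∫⁻ r in Set.Ioi (0 : ℝ), ENNReal.ofReal (r ^ n) * ENNReal.ofReal (Real.exp (-r)) =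
      ENNReal.ofReal n.factorial := by
    rw [← lintegral_pow_mul_exp]
    refine setLIntegral_congr_fun measurableSet_Ioi fun r hr => ?_
    exact (ENNReal.ofReal_mul (pow_nonneg (le_of_lt hr) _)).symm
  rw [h'] at h
  have hfac : (0 : ℝ) < n.factorial := by exact_mod_cast n.factorial_pos
  have hprod : 0 < ∏ i, a i := Finset.prod_pos fun i _ => ha₀ i
  rw [measure_simplexSection n a hs]
  have hK : μHE[n] (simplexSection a 1) = ENNReal.ofReal ((∏ i, 1 / a i) / n.factorial) := by
    rw [ENNReal.ofReal_div_of_pos hfac, h]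
    exact (ENNReal.mul_div_cancel_right (by simpa using n.factorial_ne_zero) ENNReal.ofReal_ne_top).symm
  rw [hK, ← ENNReal.ofReal_mul (by positivity)]
  congr 1
  rw [Finset.prod_div_distrib, Finset.prod_const_one]
  field_simp

/-! ### Reduction to a nonnegative unit normal -/

/-- The reflection of the cube that reverses the coordinates in which `a` is negative. -/
noncomputable def flip {d : ℕ} (a x : EuclideanSpace ℝ (Fin d)) : EuclideanSpace ℝ (Fin d) :=
  WithLp.toLp 2 fun i => if a i < 0 then 1 - x i else x i

/-- The vector of the absolute values of the coordinates of `a`. -/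
noncomputable def absVec {d : ℕ} (a : EuclideanSpace ℝ (Fin d)) : EuclideanSpace ℝ (Fin d) :=
  WithLp.toLp 2 fun i => |a i|

@[simp] lemma absVec_apply {d : ℕ} (a : EuclideanSpace ℝ (Fin d)) (i : Fin d) :
    absVec a i = |a i| := rfl

lemma flip_apply {d : ℕ} (a x : EuclideanSpace ℝ (Fin d)) (i : Fin d) :
    flip a x i = if a i < 0 then 1 - x i else x i := rfl

lemma flip_flip {d : ℕ} (a x : EuclideanSpace ℝ (Fin d)) : flip a (flip a x) = x := by
  ext i
  simp only [flip_apply]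
  split_ifs <;> ring

lemma isometry_flip {d : ℕ} (a : EuclideanSpace ℝ (Fin d)) : Isometry (flip a) := by
  refine Isometry.of_dist_eq fun x y => ?_
  rw [EuclideanSpace.dist_eq, EuclideanSpace.dist_eq]
  congr 1
  refine Finset.sum_congr rfl fun i _ => ?_
  simp only [flip_apply]
  split_ifs
  · rw [dist_sub_left]
  · rfl

lemma flip_mem_cube_iff {d : ℕ} (a x : EuclideanSpace ℝ (Fin d)) :
    flip a x ∈ cube d ↔ x ∈ cube d := by
  refine forall_congr' fun i => ?_
  rw [flip_apply]
  split_ifs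
  · simp only [Set.mem_Icc]
    constructor <;> rintro ⟨h, h'⟩ <;> constructor <;> linarith
  · rfl

lemma inner_sub_center_flip {d : ℕ} (a x : EuclideanSpace ℝ (Fin d)) :
    inner ℝ (absVec a) (flip a x - center d) = inner ℝ a (x - center d) := by
  simp only [PiLp.inner_apply]
  refine Finset.sum_congr rfl fun i _ => ?_
  simp only [PiLp.sub_apply, flip_apply, absVec_apply, center]
  split_ifs with h
  · rw [abs_of_neg h]; simp; ring
  · rw [abs_of_nonneg (not_lt.1 h)]

lemma inner_center {d : ℕ} (a : EuclideanSpace ℝ (Fin d)) :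
    inner ℝ a (center d) = (∑ i, a i) / 2 := by
  simp [PiLp.inner_apply, center, Finset.mul_sum, div_eq_inv_mul]

lemma norm_absVec {d : ℕ} (a : EuclideanSpace ℝ (Fin d)) : ‖absVec a‖ = ‖a‖ := by
  simp [EuclideanSpace.norm_eq]

lemma sectionVolume_eq_absVec {d : ℕ} (a : EuclideanSpace ℝ (Fin d)) (t : ℝ) :
    sectionVolume {x | inner ℝ a x = inner ℝ a (center d) - t} =
      sectionVolume {x | inner ℝ (absVec a) x = inner ℝ (absVec a) (center d) - t} := by
  rw [sectionVolume, sectionVolume, ← (isometry_flip a).euclideanHausdorffMeasure_image]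
  congr 1
  ext x
  constructor
  · rintro ⟨y, ⟨hy, hyc⟩, rfl⟩
    refine ⟨?_, (flip_mem_cube_iff a y).2 hyc⟩
    have := inner_sub_center_flip a y
    have hy' : inner ℝ a y = inner ℝ a (center d) - t := hy
    rw [inner_sub_right, inner_sub_right] at this
    change inner ℝ _ _ = _
    linarith
  · rintro ⟨hx, hxc⟩
    refine ⟨flip a x, ⟨?_, (flip_mem_cube_iff a x).2 hxc⟩, flip_flip a x⟩
    have := inner_sub_center_flip a (flip a x)
    have hx' : inner ℝ (absVec a) x = inner ℝ (absVec a) (center d) - t := hx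
    rw [flip_flip, inner_sub_right, inner_sub_right] at this
    change inner ℝ _ _ = _
    linarith

/-- Every hyperplane has an equation with a unit normal that points away from the hyperplane. -/
lemma IsHyperplane.exists_unit_normal {d : ℕ} {H : Set (EuclideanSpace ℝ (Fin d))}
    (hH : IsHyperplane H) {c : EuclideanSpace ℝ (Fin d)} {t : ℝ} (hdist : Metric.infDist c H = t) :
    ∃ a : EuclideanSpace ℝ (Fin d), ‖a‖ = 1 ∧ H = {x | inner ℝ a x = inner ℝ a c - t} := by
  have key : ∃ a : EuclideanSpace ℝ (Fin d), ‖a‖ = 1 ∧ ∃ b : ℝ, b ≤ inner ℝ a c ∧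
      H = {x | inner ℝ a x = b} := by
    obtain ⟨a, ha, b, rfl⟩ := hH
    have ha' : 0 < ‖a‖ := norm_pos_iff.2 ha
    rcases le_total b (inner ℝ a c) with h | h
    · refine ⟨‖a‖⁻¹ • a, norm_smul_inv_norm ha, ‖a‖⁻¹ * b, ?_, ?_⟩
      · rw [real_inner_smul_left]
        exact mul_le_mul_of_nonneg_left h (by positivity)
      · ext x
        simp only [Set.mem_ofPred_eq, real_inner_smul_left]
        exact (mul_right_inj' (by positivity)).symm
    · refine ⟨(-‖a‖⁻¹) • a, by rw [norm_smul]; simp [ha'.ne'], -‖a‖⁻¹ * b, ?_, ?_⟩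
      · rw [real_inner_smul_left]
        exact mul_le_mul_of_nonpos_left h (by simp)
      · ext x
        simp only [Set.mem_ofPred_eq, real_inner_smul_left]
        exact (mul_right_inj' (by simpa using ha)).symm
  obtain ⟨a, ha, b, hb, rfl⟩ := key
  refine ⟨a, ha, ?_⟩
  have haa : inner ℝ a a = (1 : ℝ) := by rw [real_inner_self_eq_norm_sq, ha, one_pow]
  set r := inner ℝ a c - b with hr
  have hmem : c - r • a ∈ {x : EuclideanSpace ℝ (Fin d) | inner ℝ a x = b} := by
    simp only [Set.mem_ofPred_eq, inner_sub_right, real_inner_smul_right, haa]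
    rw [hr]; ring
  have hdist' : Metric.infDist c {x | inner ℝ a x = b} = r := by
    refine le_antisymm ?_ ((Metric.le_infDist ⟨_, hmem⟩).2 fun y hy => ?_)
    · refine (Metric.infDist_le_dist_of_mem hmem).trans (le_of_eq ?_)
      rw [dist_eq_norm, sub_sub_cancel, norm_smul, ha, mul_one, Real.norm_of_nonneg]
      linarith
    · have hy' : inner ℝ a y = b := hy
      have := real_inner_le_norm a (c - y)
      rw [inner_sub_right, hy', ha, one_mul] at this
      rwa [dist_eq_norm]
  rw [← hdist, hdist', hr]
  simp

/-! ### Diagonals and normals -/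

/-- A hyperplane with unit normal `a` is orthogonal to a diagonal exactly if the coordinates of `a`
have the same absolute value. -/
lemma isOrthogonalToADiagonal_iff {d : ℕ} (hd : 0 < d) {a : EuclideanSpace ℝ (Fin d)}
    (ha : ‖a‖ = 1) (b : ℝ) :
    IsOrthogonalToADiagonal {x | inner ℝ a x = b} ↔ ∀ i, |a i| = 1 / √d := by
  have haa : inner ℝ a a = (1 : ℝ) := by rw [real_inner_self_eq_norm_sq, ha, one_pow]
  have hsum : ∑ i, |a i| ^ 2 = 1 := by
    have := EuclideanSpace.norm_sq_eq a
    simpa [ha] using this.symm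
  have hd' : (0 : ℝ) < d := by exact_mod_cast hd
  have hp : 0 < √(d : ℝ) := Real.sqrt_pos.2 hd'
  constructor
  · rintro ⟨p, q, ⟨hp₀, hq₀, hpq⟩, horth⟩
    have habs : ∀ i, |(q - p) i| = 1 := by
      intro i
      have h : midpoint ℝ p q i = 1 / 2 := by rw [hpq]; rfl
      rw [midpoint_eq_smul_add] at h
      simp only [PiLp.smul_apply, PiLp.add_apply, smul_eq_mul, invOf_eq_inv] at h
      rw [PiLp.sub_apply]
      rcases hp₀ i with h1 | h1 <;> rcases hq₀ i with h2 | h2 <;> rw [h1, h2] at h ⊢ <;>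
        first
        | (exfalso; norm_num at h; done)
        | norm_num
    set v := q - p
    set w := v - (inner ℝ a v : ℝ) • a with hw
    have haw : inner ℝ a w = (0 : ℝ) := by
      rw [hw, inner_sub_right, real_inner_smul_right, haa, mul_one, sub_self]
    -- Both `b • a` and `b • a + w` lie in the hyperplane. Being orthogonal to `v` and to `a`, the
    -- vector `w` vanishes, so `v` is a multiple of `a`.
    have hwv : inner ℝ w v = (0 : ℝ) := by
      have := horth (b • a + w)
        (by simp [inner_add_right, real_inner_smul_right, haw, ha]) (b • a)
        (by simp [real_inner_smul_right, ha])
      rwa [add_sub_cancel_left] at this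
    have hww : inner ℝ w w = (0 : ℝ) := by
      rw [show inner ℝ w w = inner ℝ w (v - (inner ℝ a v : ℝ) • a) from rfl, inner_sub_right, hwv,
        real_inner_smul_right, real_inner_comm a w, haw, mul_zero, sub_zero]
    rw [inner_self_eq_zero, hw, sub_eq_zero] at hww
    set k : ℝ := inner ℝ a v
    have hk : ∀ i, |k| * |a i| = 1 := by
      intro i
      rw [← habs i, hww, PiLp.smul_apply, smul_eq_mul, abs_mul]
    have hk2 : |k| ^ 2 = d := by
      have : ∑ i, (|k| * |a i|) ^ 2 = |k| ^ 2 := by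
        simp_rw [mul_pow, ← Finset.mul_sum, hsum, mul_one]
      rw [← this]
      simp [hk]
    have hk' : |k| = √d := by rw [← hk2, Real.sqrt_sq (abs_nonneg k)]
    intro i
    rw [eq_div_iff hp.ne', ← hk', mul_comm, hk i]
  · intro h
    -- The vertices are chosen by the signs of `a`, so that `q - p = √d • a`.
    refine ⟨WithLp.toLp 2 fun i => if a i < 0 then 1 else 0,
      WithLp.toLp 2 fun i => if a i < 0 then 0 else 1, ⟨?_, ?_, ?_⟩, ?_⟩
    · intro i
      by_cases hi : a i < 0 <;> simp [hi]
    · intro i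
      by_cases hi : a i < 0 <;> simp [hi]
    · ext i
      rw [midpoint_eq_smul_add]
      by_cases hi : a i < 0 <;> simp [hi, center]
    · intro x hx y hy
      have hx' : inner ℝ a x = b := hx
      have hy' : inner ℝ a y = b := hy
      have hv : (WithLp.toLp 2 fun i => if a i < 0 then (0 : ℝ) else 1) -
          (WithLp.toLp 2 fun i => if a i < 0 then (1 : ℝ) else 0) = √(d : ℝ) • a := by
        ext i
        have hi := h i
        rw [eq_div_iff hp.ne'] at hi
        by_cases h0 : a i < 0
        · rw [abs_of_neg h0] at hi
          simp [h0]; linarith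
        · rw [abs_of_nonneg (not_lt.1 h0)] at hi
          simp [h0]; linarith
      rw [hv, real_inner_smul_right, real_inner_comm, inner_sub_right, hx', hy', sub_self, mul_zero]

/-! ### Comparing the cube section with the simplex -/

lemma inter_cube_subset_simplexSection {d : ℕ} (a : EuclideanSpace ℝ (Fin d)) (s : ℝ) :
    {x | inner ℝ a x = s} ∩ cube d ⊆ simplexSection a s :=
  fun _ hx => ⟨fun i => (hx.2 i).1, hx.1⟩

/-- The vertices of the simplex are at `s / a i ≤ 1` on the axes, so the constraints `x i ≤ 1` are
automatic. -/
lemma inter_cube_eq_simplexSection {d : ℕ} {a : EuclideanSpace ℝ (Fin d)} (ha : ∀ i, 0 < a i)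
    {s : ℝ} (hs : ∀ i, s ≤ a i) :
    {x | inner ℝ a x = s} ∩ cube d = simplexSection a s := by
  refine (inter_cube_subset_simplexSection a s).antisymm fun x hx => ⟨hx.2, fun i => ⟨hx.1 i, ?_⟩⟩
  have hx2 : inner ℝ a x = s := hx.2
  rw [PiLp.inner_apply] at hx2
  have := Finset.single_le_sum (f := fun i => inner ℝ (a i) (x i))
    (fun j _ => by simpa using mul_nonneg (hx.1 j) (ha j).le) (Finset.mem_univ i)
  rw [hx2] at this
  have h3 : x i * a i ≤ 1 * a i := by
    rw [one_mul]
    exact (by simpa using this : x i * a i ≤ s).trans (hs i)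
  exact le_of_mul_le_mul_right h3 (ha i)

lemma simplexSection_subset_of_nonpos {d : ℕ} {a : EuclideanSpace ℝ (Fin d)} (ha : ∀ i, 0 < a i)
    {s : ℝ} (hs : s ≤ 0) : simplexSection a s ⊆ {0} := by
  intro x hx
  have hx2 : inner ℝ a x = s := hx.2
  rw [PiLp.inner_apply] at hx2
  have hnn : ∀ i ∈ Finset.univ, 0 ≤ inner ℝ (a i) (x i) := fun i _ => by
    simpa using mul_nonneg (hx.1 i) (ha i).le
  have h0 := (Finset.sum_eq_zero_iff_of_nonneg hnn).1
    (le_antisymm (hx2.le.trans hs) (Finset.sum_nonneg hnn))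
  ext i
  have := h0 i (Finset.mem_univ i)
  simpa [(ha i).ne'] using this

lemma euclideanHausdorffMeasure_singleton {d n : ℕ} (hn : 0 < n) (x : EuclideanSpace ℝ (Fin d)) :
    μHE[n] {x} = 0 := by
  have := Measure.nullSingletonClass_hausdorff (EuclideanSpace ℝ (Fin d)) (d := n) (by exact_mod_cast hn)
  rw [Measure.euclideanHausdorffMeasure_def, Measure.smul_apply, measure_singleton, smul_zero]

/-- If the coordinate sum of a unit vector exceeds `√n`, none of its `n + 1` coordinates
vanishes. -/
lemma ne_zero_of_sqrt_lt_sum {n : ℕ} {a : Fin (n + 1) → ℝ} (h₂ : ∑ i, a i ^ 2 = 1)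
    (hσ : √n < ∑ i, a i) (i : Fin (n + 1)) : a i ≠ 0 := by
  intro hi
  have hcs := sq_sum_le_card_mul_sum_sq (s := Finset.univ.erase i) (f := a)
  rw [Finset.card_erase_of_mem (Finset.mem_univ i), Finset.card_univ, Fintype.card_fin,
    Nat.add_sub_cancel, Finset.sum_erase _ hi, Finset.sum_erase _ (by rw [hi]; simp), h₂,
    mul_one] at hcs
  exact absurd (Real.abs_le_sqrt hcs) (not_le.2 (hσ.trans_le (le_abs_self _)))

lemma sum_le_sqrt {n : ℕ} {a : Fin n → ℝ} (h₂ : ∑ i, a i ^ 2 = 1) : ∑ i, a i ≤ √n := by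
  have hcs := sq_sum_le_card_mul_sum_sq (s := Finset.univ) (f := a)
  rw [h₂, mul_one, Finset.card_univ, Fintype.card_fin] at hcs
  exact (le_abs_self _).trans (Real.abs_le_sqrt hcs)

lemma eq_of_sum_eq_sqrt {n : ℕ} (hn : 0 < n) {a : Fin n → ℝ} (h₂ : ∑ i, a i ^ 2 = 1)
    (h : ∑ i, a i = √n) (i : Fin n) : a i = 1 / √n := by
  have hp : 0 < √(n : ℝ) := Real.sqrt_pos.2 (by exact_mod_cast hn)
  have hp2 : √(n : ℝ) ^ 2 = n := Real.sq_sqrt (by positivity)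
  have hz : ∑ i, (a i - 1 / √n) ^ 2 = 0 := by
    simp_rw [sub_sq, Finset.sum_add_distrib, Finset.sum_sub_distrib, h₂, ← Finset.sum_mul,
      ← Finset.mul_sum, h, Finset.sum_const, Finset.card_univ, Fintype.card_fin, nsmul_eq_mul]
    field_simp
    rw [hp2]
    ring
  have := (Finset.sum_eq_zero_iff_of_nonneg fun i _ => sq_nonneg _).1 hz i (Finset.mem_univ i)
  have := pow_eq_zero_iff (two_ne_zero) |>.1 this
  linarith

/-- The volume of a section by a hyperplane with unit nonnegative normal. -/
lemma sectionVolume_of_nonneg {n : ℕ} (hn : 2 ≤ n) {a : EuclideanSpace ℝ (Fin (n + 1))}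
    (ha : ‖a‖ = 1) (ha₀ : ∀ i, 0 ≤ a i) {t : ℝ} (ht₁ : √n / 2 < t) (ht₂ : t < √(n + 1) / 2) :
    ((∀ i, a i = 1 / √(n + 1)) →
      sectionVolume {x | inner ℝ a x = inner ℝ a (center (n + 1)) - t} =
        ENNReal.ofReal (√(n + 1) ^ (n + 1) / n.factorial * (√(n + 1) / 2 - t) ^ n)) ∧
    ((¬ ∀ i, a i = 1 / √(n + 1)) →
      sectionVolume {x | inner ℝ a x = inner ℝ a (center (n + 1)) - t} <
        ENNReal.ofReal (√(n + 1) ^ (n + 1) / n.factorial * (√(n + 1) / 2 - t) ^ n)) := by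
  have h₂ : ∑ i, a i ^ 2 = 1 := by
    have := EuclideanSpace.norm_sq_eq a
    simpa [ha] using this.symm
  have hp : 0 < √((n : ℝ) + 1) := Real.sqrt_pos.2 (by positivity)
  have hp2 : √((n : ℝ) + 1) ^ 2 = n + 1 := Real.sq_sqrt (by positivity)
  have hm2 : √(n : ℝ) ^ 2 = n := Real.sq_sqrt (by positivity)
  have hfac : (0 : ℝ) < n.factorial := by exact_mod_cast n.factorial_pos
  have hs₀ : 0 < √((n : ℝ) + 1) / 2 - t := by linarith
  rw [inner_center]
  unfold sectionVolume
  rw [Nat.add_sub_cancel]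
  constructor
  · intro h
    have hpos : ∀ i, 0 < a i := fun i => by rw [h i]; positivity
    have hσ : ∑ i, a i = √((n : ℝ) + 1) := by
      simp_rw [h, Finset.sum_const, Finset.card_univ, Fintype.card_fin, nsmul_eq_mul]
      push_cast
      nth_rewrite 1 [← hp2]
      field_simp
    have hP : ∏ i, a i = 1 / √((n : ℝ) + 1) ^ (n + 1) := by
      simp_rw [h, Finset.prod_const, Finset.card_univ, Fintype.card_fin, div_pow, one_pow]
    rw [hσ, inter_cube_eq_simplexSection hpos, volume_simplexSection ha hpos hs₀, hP]
    · congr 1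
      field_simp
    -- The simplex fits in the cube: `t > √n / 2` gives `s √(n + 1) < ((n + 1) - √n √(n + 1)) / 2 ≤
    -- 1 / 2`.
    · intro i
      rw [h i, le_div_iff₀ hp]
      nlinarith [mul_pos hp hs₀, Real.sqrt_nonneg (n : ℝ),
        Real.sqrt_le_sqrt (by linarith : (n : ℝ) ≤ n + 1)]
  · intro h
    have hσ' : ∑ i, a i < √((n : ℝ) + 1) := by
      refine lt_of_le_of_ne (by simpa using sum_le_sqrt h₂) fun he => h fun i => ?_
      simpa using eq_of_sum_eq_sqrt n.succ_pos h₂ (by simpa using he) i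
    have hbound : 0 < √((n : ℝ) + 1) ^ (n + 1) / n.factorial * (√(n + 1) / 2 - t) ^ n := by
      positivity
    refine (measure_mono (inter_cube_subset_simplexSection _ _)).trans_lt ?_
    -- The slice is empty, contained in `{0}`, or a true simplex, according to the sign of `s`. Zero
    -- coordinates of `a` can occur only in the first case.
    rcases lt_or_ge ((∑ i, a i) / 2 - t) 0 with hs | hs
    · have hempty : simplexSection a ((∑ i, a i) / 2 - t) = ∅ :=
        Set.eq_empty_of_forall_notMem fun x hx => absurd
          (show inner ℝ a x = (∑ i, a i) / 2 - t from hx.2)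
          (hs.trans_le (inner_nonneg_of_mem_orthant ha₀ hx.1)).ne'
      rw [hempty, measure_empty]
      exact ENNReal.ofReal_pos.2 hbound
    · have hσ : √(n : ℝ) < ∑ i, a i := by linarith
      have hpos : ∀ i, 0 < a i := fun i =>
        lt_of_le_of_ne (ha₀ i) (ne_zero_of_sqrt_lt_sum h₂ hσ i).symm
      rcases hs.eq_or_lt with hs | hs
      · refine (measure_mono (simplexSection_subset_of_nonpos hpos hs.symm.le)).trans_lt ?_
        rw [euclideanHausdorffMeasure_singleton (by omega)]
        exact ENNReal.ofReal_pos.2 hbound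
      · have hP : 0 < ∏ i, a i := Finset.prod_pos fun i _ => hpos i
        rw [volume_simplexSection ha hpos hs, ENNReal.ofReal_lt_ofReal_iff hbound,
          div_lt_iff₀ (by positivity)]
        refine (simplex_ineq hn h₂ ht₁ hs hσ').trans_eq ?_
        field_simp

end CubeSection

theorem mainTheorem3 (d : ℕ) (hd : 3 ≤ d) (t : ℝ)
    (ht₁ : Real.sqrt ((d : ℝ) - 1) / 2 < t) (ht₂ : t < Real.sqrt (d : ℝ) / 2)
    (H : Set (EuclideanSpace ℝ (Fin d))) (hH : CubeSection.IsHyperplane H)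
    (hdist : Metric.infDist (CubeSection.center d) H = t) :
    CubeSection.sectionVolume H ≤
        ENNReal.ofReal ((d : ℝ) ^ ((d : ℝ) / 2) / ((d - 1).factorial : ℝ) *
          (Real.sqrt (d : ℝ) / 2 - t) ^ (d - 1)) ∧
      (CubeSection.sectionVolume H =
          ENNReal.ofReal ((d : ℝ) ^ ((d : ℝ) / 2) / ((d - 1).factorial : ℝ) *
            (Real.sqrt (d : ℝ) / 2 - t) ^ (d - 1)) ↔
        CubeSection.IsOrthogonalToADiagonal H) := by
  obtain ⟨n, rfl⟩ : ∃ n, d = n + 1 := ⟨d - 1, by omega⟩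
  obtain ⟨a, ha, rfl⟩ := hH.exists_unit_normal hdist
  have hpow : ((n + 1 : ℕ) : ℝ) ^ (((n + 1 : ℕ) : ℝ) / 2) = √((n : ℝ) + 1) ^ (n + 1) := by
    rw [Real.sqrt_eq_rpow, ← Real.rpow_natCast, ← Real.rpow_mul (by positivity)]
    push_cast
    ring_nf
  have hcast : ((n + 1 : ℕ) : ℝ) = n + 1 := by push_cast; rfl
  have hmain := CubeSection.sectionVolume_of_nonneg (by omega)
    ((CubeSection.norm_absVec a).trans ha) (fun i => abs_nonneg (a i))
    (by simpa using ht₁) (by rwa [hcast] at ht₂)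
  rw [CubeSection.isOrthogonalToADiagonal_iff n.succ_pos ha, CubeSection.sectionVolume_eq_absVec,
    hpow, hcast, Nat.add_sub_cancel]
  simp only [CubeSection.absVec_apply] at hmain
  by_cases h : ∀ i, |a i| = 1 / √((n : ℝ) + 1)
  · exact ⟨(hmain.1 h).le, fun _ => h, hmain.1⟩
  · exact ⟨(hmain.2 h).le, fun he => absurd he (hmain.2 h).ne, fun h' => absurd h' h⟩
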